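/- Let $G$ be a paratopological group, that is, a group with a topology for which the multiplication $G\times G\to G$ is jointly continuous, and assume that the space $G$ is Tychonoff (completely regular and Hausdorff) and not locally compact. Assume that $G$ is $k$-gentle: for every compact set $F\subseteq G$, the set $F^{-1}=\{x^{-1}:x\in F\}$ is compact. A remainder of $G$ is a subspace $bG\setminus G$, where $bG$ is a Hausdorff compactification of $G$ (a compact Hausdorff space containing $G$ as a dense subspace). Then either every remainder of $G$ is a Baire space (the intersection of every sequence of dense open subsets is dense), or every remainder of $G$ is $\sigma$-compact (a union of countably many compact subsets). -/

import Mathlib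

/-- A map is `k`-gentle if the image of every compact set is compact. -/
def IsKGentle {X Y : Type*} [TopologicalSpace X] [TopologicalSpace Y] (f : X → Y) : Prop :=
  ∀ F : Set X, IsCompact F → IsCompact (f '' F)

/-- `e : X → K` is a Hausdorff compactification of `X`: the space `K` is compact Hausdorff and
`e` is a homeomorphism of `X` onto a dense subspace of `K`. -/
structure IsHausdorffCompactification {X K : Type*} [TopologicalSpace X] [TopologicalSpace K]
    (e : X → K) : Prop where
  compactSpace : CompactSpace K
  t2Space : T2Space K
  isEmbedding : Topology.IsEmbedding e
  denseRange : DenseRange e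

/-- The remainder `K \ X` of a compactification `e : X → K`. Coerced to a type, it carries the
subspace topology. -/
def remainder {X K : Type*} (e : X → K) : Set K :=
  (Set.range e)ᶜ

open Filter Topology Set

/-! If some remainder is not Baire, a nonempty open part of it misses a countable intersection of
dense open sets. As `G` is homogeneous and not locally compact, the remainder is dense, so `G`
contains a dense G-delta of a nonempty open set of the compactification; hence a complete `π`-base.

Nesting its members and translating gives a complete sequence of neighbourhoods of `1`. Its
intersection is compact, and there `k`-gentleness forces inversion to be continuous: `G` is a
topological group.

A category argument in the style of the Raikov completion now shows that `G` is complete: for a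
Cauchy limit `ĝ`, a dense G-delta and its translate by `ĝ` must meet, whence `ĝ ∈ G`. Small
two-sided neighbourhoods thus form a complete sequence of covers. This property is intrinsic to `G`
and makes every remainder σ-compact. -/

/-- A nonempty open set `U` with a sequence `P` of families of open sets, each of them a `π`-base
of `U`, such that every ultrafilter that meets all the families converges. -/
structure IsCompletePiBase {X : Type*} [TopologicalSpace X] (U : Set X)
    (P : ℕ → Set X → Prop) : Prop where
  isOpen : IsOpen U
  nonempty : U.Nonempty
  exists_subset : ∀ n O, IsOpen O → O.Nonempty → O ⊆ U →
    ∃ O' ⊆ O, IsOpen O' ∧ O'.Nonempty ∧ P n O'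
  converges : ∀ F : Ultrafilter X, (∀ n, ∃ O ∈ F, P n O) → ∃ x, (F : Filter X) ≤ 𝓝 x

/-- A decreasing sequence of open neighbourhoods of `x`, each containing the closure of the next,
such that every ultrafilter containing all of them converges. -/
structure IsCompleteNhdsSeq {X : Type*} [TopologicalSpace X] (x : X) (M : ℕ → Set X) : Prop where
  isOpen : ∀ n, IsOpen (M n)
  mem : ∀ n, x ∈ M n
  closure_subset : ∀ n, closure (M (n + 1)) ⊆ M n
  converges : ∀ F : Ultrafilter X, (∀ n, M n ∈ F) → ∃ x, (F : Filter X) ≤ 𝓝 x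

theorem exists_ultrafilter_of_antitone {X : Type*} {M : ℕ → Set X} (hM : Antitone M)
    (hne : ∀ n, (M n).Nonempty) : ∃ F : Ultrafilter X, ∀ n, M n ∈ F := by
  have : (⨅ n, 𝓟 (M n)).NeBot := by
    have : Nonempty X := ⟨(hne 0).some⟩
    refine Filter.iInf_neBot_of_directed ?_ fun n => principal_neBot_iff.2 (hne n)
    exact Antitone.directed_ge fun m n h => principal_mono.2 (hM h)
  exact ⟨Ultrafilter.of _, fun n => (Ultrafilter.of_le (⨅ n, 𝓟 (M n)))
    (mem_iInf_of_mem n (mem_principal_self _))⟩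

theorem exists_open_nhds_closure_subset {X : Type*} [TopologicalSpace X] [RegularSpace X]
    {O : Set X} (hO : IsOpen O) {x : X} (hx : x ∈ O) :
    ∃ V, IsOpen V ∧ x ∈ V ∧ closure V ⊆ O := by
  obtain ⟨C, hC, hCcl, hCO⟩ := exists_mem_nhds_isClosed_subset (hO.mem_nhds hx)
  exact ⟨interior C, isOpen_interior, mem_interior_iff_mem_nhds.2 hC,
    (closure_minimal interior_subset hCcl).trans hCO⟩

/-! ### Complete sequences of neighbourhoods -/

namespace IsCompleteNhdsSeq

variable {X : Type*} [TopologicalSpace X] {x : X} {M : ℕ → Set X}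

theorem antitone (h : IsCompleteNhdsSeq x M) : Antitone M :=
  antitone_nat_of_succ_le fun n => subset_closure.trans (h.closure_subset n)

theorem limit_mem (h : IsCompleteNhdsSeq x M) {F : Ultrafilter X} (hF : ∀ n, M n ∈ F) {y : X}
    (hy : (F : Filter X) ≤ 𝓝 y) : y ∈ ⋂ n, M n :=
  mem_iInter.2 fun n => h.closure_subset n
    (mem_closure_iff_ultrafilter.2 ⟨F, hF (n + 1), hy⟩)

theorem isCompact_iInter (h : IsCompleteNhdsSeq x M) : IsCompact (⋂ n, M n) := by
  rw [isCompact_iff_ultrafilter_le_nhds]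
  intro F hF
  have hF' : ∀ n, M n ∈ F := fun n =>
    mem_of_superset (le_principal_iff.1 hF) (iInter_subset _ n)
  obtain ⟨y, hy⟩ := h.converges F hF'
  exact ⟨y, h.limit_mem hF' hy, hy⟩

theorem exists_subset_biUnion (h : IsCompleteNhdsSeq x M) (O : X → Set X)
    (hO : ∀ y, IsOpen (O y)) (hmem : ∀ y, y ∈ O y) :
    ∃ n, ∃ t : Finset X, M n ⊆ ⋃ y ∈ t, O y := by
  obtain ⟨t, ht⟩ := h.isCompact_iInter.elim_finite_subcover O hO
    fun y _ => mem_iUnion.2 ⟨y, hmem y⟩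
  by_contra! hcon
  obtain ⟨F, hF⟩ := exists_ultrafilter_of_antitone (M := fun n => M n \ ⋃ y ∈ t, O y)
    (fun m n hmn => sdiff_subset_sdiff_left (h.antitone hmn))
    (fun n => sdiff_nonempty.2 (hcon n t))
  have hF' : ∀ n, M n ∈ F := fun n => mem_of_superset (hF n) sdiff_subset
  obtain ⟨y, hy⟩ := h.converges F hF'
  have h1 : (⋃ y ∈ t, O y) ∈ F := hy
    ((isOpen_biUnion fun y _ => hO y).mem_nhds (ht (h.limit_mem hF' hy)))
  obtain ⟨z, hz⟩ := F.nonempty_of_mem (inter_mem h1 (hF 0))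
  exact hz.2.2 hz.1

end IsCompleteNhdsSeq

theorem IsCompletePiBase.exists_isCompleteNhdsSeq {X : Type*} [TopologicalSpace X]
    [RegularSpace X] {U : Set X} {P : ℕ → Set X → Prop} (h : IsCompletePiBase U P) :
    ∃ x M, IsCompleteNhdsSeq (X := X) x M := by
  have step : ∀ n (O : {O : Set X // IsOpen O ∧ O.Nonempty ∧ O ⊆ U}),
      ∃ O' : {O : Set X // IsOpen O ∧ O.Nonempty ∧ O ⊆ U},
        closure O'.1 ⊆ O.1 ∧ P n O'.1 := by
    rintro n ⟨O, hO, ⟨x, hx⟩, hOU⟩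
    obtain ⟨V, hxV, hV, hVO⟩ := exists_open_nhds_closure_subset hO hx
    obtain ⟨O', hO'V, hO', hne, hP⟩ :=
      h.exists_subset n V hxV ⟨x, hV⟩ (subset_closure.trans (hVO.trans hOU))
    exact ⟨⟨O', hO', hne, hO'V.trans (subset_closure.trans (hVO.trans hOU))⟩,
      (closure_mono hO'V).trans hVO, hP⟩
  choose next hcl hP using step
  let S : ℕ → {O : Set X // IsOpen O ∧ O.Nonempty ∧ O ⊆ U} := fun n =>
    Nat.rec ⟨U, h.isOpen, h.nonempty, Subset.rfl⟩ next n
  have hclS : ∀ n, closure (S (n + 1)).1 ⊆ (S n).1 := fun n => hcl n (S n)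
  have hPS : ∀ n, P n (S (n + 1)).1 := fun n => hP n (S n)
  have hconv : ∀ F : Ultrafilter X, (∀ n, (S n).1 ∈ F) → ∃ x, (F : Filter X) ≤ 𝓝 x :=
    fun F hF => h.converges F fun n => ⟨_, hF (n + 1), hPS n⟩
  obtain ⟨F, hF⟩ := exists_ultrafilter_of_antitone (M := fun n => (S n).1)
    (antitone_nat_of_succ_le fun n => subset_closure.trans (hclS n)) fun n => (S n).2.2.1
  obtain ⟨x, hx⟩ := hconv F hF
  exact ⟨x, fun n => (S n).1, fun n => (S n).2.1, fun n => hclS n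
    (mem_closure_iff_ultrafilter.2 ⟨F, hF (n + 1), hx⟩), hclS, hconv⟩

theorem IsCompleteNhdsSeq.image_homeomorph {X Y : Type*} [TopologicalSpace X]
    [TopologicalSpace Y] {x : X} {M : ℕ → Set X} (h : IsCompleteNhdsSeq x M) (f : X ≃ₜ Y) :
    IsCompleteNhdsSeq (f x) fun n => f '' M n where
  isOpen n := f.isOpenMap _ (h.isOpen n)
  mem n := mem_image_of_mem f (h.mem n)
  closure_subset n := by
    rw [← f.image_closure]
    exact image_mono (h.closure_subset n)
  converges F hF := by
    obtain ⟨y, hy⟩ := h.converges (F.map f.symm) fun n => by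
      rw [Ultrafilter.mem_map, ← f.image_eq_preimage_symm]
      exact hF n
    refine ⟨f y, ?_⟩
    have := (f.continuous.tendsto y).comp (show Tendsto f.symm F (𝓝 y) from hy)
    simpa [Function.comp_def, Tendsto] using this

/-! ### Continuity of inversion -/

/-- In the presence of a complete sequence of neighbourhoods, a `k`-gentle inversion is
continuous at the identity. -/
theorem tendsto_inv_one_of_isKGentle {G : Type*} [Group G] [TopologicalSpace G] [T3Space G]
    {M : ℕ → Set G} (hM : IsCompleteNhdsSeq 1 M) (hgentle : IsKGentle (fun x : G => x⁻¹)) :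
    Tendsto (fun x : G => x⁻¹) (𝓝 1) (𝓝 1) := by
  rw [(nhds_basis_opens (1 : G)).tendsto_right_iff]
  rintro N ⟨h1N, hN⟩
  by_contra hcon
  -- This set is the inverse of the compact set `L⁻¹ \ N`.
  have hE : ∀ L : Set G, IsCompact L → IsCompact {x ∈ L | x⁻¹ ∉ N} := by
    intro L hL
    convert hgentle _ ((hgentle L hL).inter_right hN.isClosed_compl) using 1
    ext x
    constructor
    · rintro ⟨hx, hxN⟩
      exact ⟨x⁻¹, ⟨⟨x, hx, rfl⟩, hxN⟩, inv_inv x⟩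
    · rintro ⟨_, ⟨⟨y, hy, rfl⟩, hyN⟩, rfl⟩
      simpa using ⟨hy, hyN⟩
  have h1 : (1 : G) ∈ {x ∈ ⋂ n, M n | x⁻¹ ∉ N}ᶜ := fun h => h.2 (by simpa using h1N)
  obtain ⟨V, hV, h1V, hVE⟩ := exists_open_nhds_closure_subset
    (hE _ hM.isCompact_iInter).isClosed.isOpen_compl h1
  have hex : ∀ n, ∃ x, x ∈ M n ∧ x ∈ V ∧ x⁻¹ ∉ N := by
    intro n
    have := (Filter.not_eventually.1 hcon).and_eventually
      (inter_mem ((hM.isOpen n).mem_nhds (hM.mem n)) (hV.mem_nhds h1V))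
    obtain ⟨x, hx, hxM, hxV⟩ := this.exists
    exact ⟨x, hxM, hxV, hx⟩
  choose x hxM hxV hxN using hex
  have htail : ∀ F : Ultrafilter G, (∀ n, x '' Ici n ∈ F) → ∀ n, M n ∈ F := fun F hF n =>
    mem_of_superset (hF n) (by
      rintro _ ⟨m, hm, rfl⟩
      exact hM.antitone hm (hxM m))
  -- An ultrafilter on the sequence either contains every tail, and converges into the intersection,
  -- or lives on finitely many terms.
  have hL : IsCompact ((⋂ n, M n) ∪ range x) := by
    rw [isCompact_iff_ultrafilter_le_nhds]
    intro F hF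
    rcases Ultrafilter.union_mem_iff.1 (le_principal_iff.1 hF) with h | h
    · obtain ⟨y, hy, hle⟩ := isCompact_iff_ultrafilter_le_nhds.1 hM.isCompact_iInter F
        (le_principal_iff.2 h)
      exact ⟨y, Or.inl hy, hle⟩
    · by_cases ht : ∀ n, x '' Ici n ∈ F
      · obtain ⟨y, hy⟩ := hM.converges F (htail F ht)
        exact ⟨y, Or.inl (hM.limit_mem (htail F ht) hy), hy⟩
      · push Not at ht
        obtain ⟨n, hn⟩ := ht
        have hfin : x '' Iio n ∈ F := by
          rw [← image_univ, ← Iio_union_Ici (a := n), image_union] at h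
          exact (Ultrafilter.union_mem_iff.1 h).resolve_right hn
        obtain ⟨y, hy, hle⟩ := isCompact_iff_ultrafilter_le_nhds.1
          ((finite_Iio n).image x).isCompact F (le_principal_iff.2 hfin)
        exact ⟨y, Or.inr (image_subset_range _ _ hy), hle⟩
  -- A cluster point of the bad sequence is a bad point of the intersection lying in `closure V`,
  -- which `V` was chosen to exclude.
  obtain ⟨F, hF⟩ := exists_ultrafilter_of_antitone (M := fun n => x '' Ici n)
    (fun m n hmn => image_mono (Ici_subset_Ici.2 hmn)) fun n => nonempty_Ici.image x
  obtain ⟨y, hy⟩ := hM.converges F (htail F hF)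
  have hyC := hM.limit_mem (htail F hF) hy
  have hyE : y ∈ {z ∈ (⋂ n, M n) ∪ range x | z⁻¹ ∉ N} :=
    (hE _ hL).isClosed.closure_subset (mem_closure_iff_ultrafilter.2 ⟨F, mem_of_superset (hF 0) (by
      rintro _ ⟨m, -, rfl⟩
      exact ⟨Or.inr ⟨m, rfl⟩, hxN m⟩), hy⟩)
  have hyV : y ∈ closure V := mem_closure_iff_ultrafilter.2 ⟨F, mem_of_superset (hF 0) (by
      rintro _ ⟨m, -, rfl⟩
      exact hxV m), hy⟩
  exact hVE hyV ⟨hyC, hyE.2⟩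

theorem isTopologicalGroup_of_tendsto_inv_one {G : Type*} [Group G] [TopologicalSpace G]
    [ContinuousMul G] (h : Tendsto (fun x : G => x⁻¹) (𝓝 1) (𝓝 1)) : IsTopologicalGroup G where
  continuous_inv := by
    rw [continuous_iff_continuousAt]
    intro g
    have h1 : Tendsto (fun x : G => g⁻¹ * x) (𝓝 g) (𝓝 1) := by
      simpa using (continuous_const_mul g⁻¹).tendsto g
    have h2 := (h.comp h1).mul_const g⁻¹
    simpa [ContinuousAt, Function.comp_def] using h2

/-! ### Two-sided completeness -/

section Raikov

variable {G : Type*} [Group G] [TopologicalSpace G]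

/-- A filter on a group is two-sided Cauchy if it has small members for both the left and the
right uniformity. -/
def IsTwoSidedCauchy (F : Filter G) : Prop :=
  ∀ N ∈ 𝓝 (1 : G), ∃ f ∈ F, ∀ g ∈ f, ∀ h ∈ f, g⁻¹ * h ∈ N ∧ g * h⁻¹ ∈ N

/-- The translate by `a` of the limit of `F` in the completion is interior to `B`. -/
def MulLimitInterior (F : Filter G) (a : G) (B : Set G) : Prop :=
  ∃ N ∈ 𝓝 (1 : G), ∀ᶠ g in F, ∀ n ∈ N, n * (a * g) ∈ B

variable [IsTopologicalGroup G] {F : Filter G}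

theorem exists_nhds_one_mul_subset {N : Set G} (hN : N ∈ 𝓝 (1 : G)) :
    ∃ V ∈ 𝓝 (1 : G), ∀ v ∈ V, ∀ w ∈ V, v * w ∈ N := by
  obtain ⟨V, hV, hV1, h⟩ := exists_open_nhds_one_mul_subset hN
  exact ⟨V, hV.mem_nhds hV1, fun v hv w hw => h (Set.mul_mem_mul hv hw)⟩

/-- Conjugation by one fixed `a * g₀` turns right neighbourhoods into left ones; the Cauchy
condition absorbs the change from `g₀` to `g`. -/
theorem mulLimitInterior_of_right [F.NeBot] (hF : IsTwoSidedCauchy F) {a : G} {B N : Set G}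
    (hN : N ∈ 𝓝 (1 : G)) (h : ∀ᶠ g in F, ∀ n ∈ N, a * g * n ∈ B) : MulLimitInterior F a B := by
  obtain ⟨N₁, hN₁, hmul⟩ := exists_nhds_one_mul_subset hN
  obtain ⟨f, hf, hfN⟩ := hF N₁ hN₁
  obtain ⟨g₀, hg₀f, hg₀⟩ := F.nonempty_of_mem (inter_mem hf h)
  have hcont : Tendsto (fun n : G => (a * g₀)⁻¹ * n * (a * g₀)) (𝓝 1) (𝓝 1) := by
    have : Continuous fun n : G => (a * g₀)⁻¹ * n * (a * g₀) := by fun_prop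
    simpa using this.tendsto 1
  refine ⟨_, hcont hN₁, mem_of_superset hf fun g hg n hn => ?_⟩
  have := hg₀ _ (hmul _ hn _ (hfN g₀ hg₀f g hg).1)
  convert this using 1
  group

theorem MulLimitInterior.exists_shrink_left {a : G} {A B : Set G} (h : MulLimitInterior F a B)
    (hA : A ∈ 𝓝 a) {p : Set G → Prop}
    (hp : ∀ O, IsOpen O → O.Nonempty → O ⊆ A → ∃ O' ⊆ O, IsOpen O' ∧ O'.Nonempty ∧ p O') :
    ∃ A' ⊆ A, IsOpen A' ∧ p A' ∧ ∃ a' ∈ A', MulLimitInterior F a' B := by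
  obtain ⟨N, hN, hB⟩ := h
  obtain ⟨N₁, hN₁, hmul⟩ := exists_nhds_one_mul_subset hN
  have hcont : Tendsto (fun y : G => y * a⁻¹) (𝓝 a) (𝓝 1) := by
    simpa using (continuous_mul_const a⁻¹).tendsto a
  obtain ⟨O, hO, hOopen, haO⟩ := mem_nhds_iff.1 (inter_mem hA (hcont hN₁))
  obtain ⟨A', hA'O, hA', ⟨a', ha'⟩, hpA'⟩ := hp O hOopen ⟨a, haO⟩ fun y hy => (hO hy).1
  refine ⟨A', fun y hy => (hO (hA'O hy)).1, hA', hpA', a', ha', N₁, hN₁, ?_⟩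
  filter_upwards [hB] with g hg n hn
  convert hg _ (hmul n hn _ (hO (hA'O ha')).2) using 1
  group

theorem MulLimitInterior.exists_shrink_right [F.NeBot] (hF : IsTwoSidedCauchy F) {a : G}
    {A B : Set G} (h : MulLimitInterior F a B) (hA : A ∈ 𝓝 a) {p : Set G → Prop}
    (hp : ∀ O, IsOpen O → O.Nonempty → O ⊆ B → ∃ O' ⊆ O, IsOpen O' ∧ O'.Nonempty ∧ p O') :
    ∃ B' ⊆ B, IsOpen B' ∧ p B' ∧ ∃ a' ∈ A, MulLimitInterior F a' B' := by
  obtain ⟨N, hN, hB⟩ := h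
  have hcont : Tendsto (fun n : G => n * a) (𝓝 1) (𝓝 a) := by
    simpa using (continuous_mul_const a).tendsto 1
  obtain ⟨N₁, hN₁, hmul⟩ := exists_nhds_one_mul_subset (hcont hA)
  have hconj : Tendsto (fun n : G => a * n * a⁻¹) (𝓝 1) (𝓝 1) := by
    have : Continuous fun n : G => a * n * a⁻¹ := by fun_prop
    simpa using this.tendsto 1
  obtain ⟨f, hf, hfN⟩ := hF _ (hconj hN₁)
  obtain ⟨g₀, hg₀f, hg₀⟩ := F.nonempty_of_mem (inter_mem hf hB)
  have hdiv : Tendsto (fun y : G => y * (a * g₀)⁻¹) (𝓝 (a * g₀)) (𝓝 1) := by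
    simpa using (continuous_mul_const (a * g₀)⁻¹).tendsto (a * g₀)
  obtain ⟨O, hO, hOopen, haO⟩ := mem_nhds_iff.1 (hdiv (inter_mem hN hN₁))
  obtain ⟨B', hB'O, hB', ⟨d, hd⟩, hpB'⟩ := hp O hOopen ⟨_, haO⟩ fun y hy => by
    simpa only [inv_mul_cancel_right] using hg₀ _ (hO hy).1
  have hdN₁ := (hO (hB'O hd)).2
  have hBB : B' ⊆ B := fun y hy => by
    simpa only [inv_mul_cancel_right] using hg₀ _ (hO (hB'O hy)).1
  have hdcont : Tendsto (fun n : G => d * n) (𝓝 1) (𝓝 d) := by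
    simpa using (continuous_const_mul d).tendsto 1
  obtain ⟨N₂, hN₂, hmul₂⟩ := exists_nhds_one_mul_subset (hdcont (hB'.mem_nhds hd))
  obtain ⟨f₂, hf₂, hfN₂⟩ := hF N₂ hN₂
  obtain ⟨g₁, hg₁, hg₁f₂⟩ := F.nonempty_of_mem (inter_mem hf hf₂)
  -- `d * g₁⁻¹` sends the limit close to `d ∈ B'`, and is close to `a` because `d` is close to `a *
  -- g₀` and `g₁` to `g₀`.
  refine ⟨B', hBB, hB', hpB', d * g₁⁻¹, ?_, mulLimitInterior_of_right hF hN₂ ?_⟩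
  · have : d * (a * g₀)⁻¹ * (a * (g₀ * g₁⁻¹) * a⁻¹) * a ∈ A :=
      hmul _ hdN₁ _ (hfN g₀ hg₀f g₁ hg₁).2
    convert this using 1
    group
  · filter_upwards [hf₂] with g hg n hn
    have : d * (g₁⁻¹ * g * n) ∈ B' := hmul₂ _ (hfN₂ g₁ hg₁f₂ g hg).1 n hn
    convert this using 1
    group

theorem exists_le_nhds_of_mulLimitInterior {U : Set G} {P : ℕ → Set G → Prop}
    (hP : IsCompletePiBase U P) {F : Ultrafilter G} (hF : IsTwoSidedCauchy (F : Filter G))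
    {a : G} (ha : a ∈ U) (haF : MulLimitInterior (F : Filter G) a U) :
    ∃ x, (F : Filter G) ≤ 𝓝 x := by
  let State := {p : Set G × Set G // (IsOpen p.1 ∧ p.1 ⊆ U) ∧ (IsOpen p.2 ∧ p.2 ⊆ U) ∧
    ∃ a ∈ p.1, MulLimitInterior (F : Filter G) a p.2}
  have step : ∀ n (s : State), ∃ t : State,
      (t.1.1 ⊆ s.1.1 ∧ t.1.2 ⊆ s.1.2) ∧ P n t.1.1 ∧ P n t.1.2 := by
    rintro n ⟨⟨A, B⟩, ⟨hA, hAU⟩, ⟨hB, hBU⟩, a, ha, haB⟩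
    obtain ⟨A', hA'A, hA', hPA', a', ha', haB'⟩ := haB.exists_shrink_left (hA.mem_nhds ha)
      (p := P n) fun O hO hne hOA => hP.exists_subset n O hO hne (hOA.trans hAU)
    obtain ⟨B', hB'B, hB', hPB', a'', ha'', h⟩ := haB'.exists_shrink_right hF
      (hA'.mem_nhds ha') (p := P n)
      fun O hO hne hOB => hP.exists_subset n O hO hne (hOB.trans hBU)
    exact ⟨⟨⟨A', B'⟩, ⟨hA', hA'A.trans hAU⟩, ⟨hB', hB'B.trans hBU⟩, a'', ha'', h⟩,
      ⟨hA'A, hB'B⟩, hPA', hPB'⟩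
  choose next hsub hPA hPB using step
  let S : ℕ → State := fun n =>
    Nat.rec ⟨⟨U, U⟩, ⟨hP.isOpen, Subset.rfl⟩, ⟨hP.isOpen, Subset.rfl⟩, a, ha, haF⟩ next n
  -- An ultrafilter on pairs `(b, g)` lying over `F` sends `b` to some `z` and `b * g` to some `y`,
  -- so `F` tends to `z⁻¹ * y`.
  let T : ℕ → Set (G × G) := fun n => {q | q.1 ∈ (S n).1.1 ∧ q.1 * q.2 ∈ (S n).1.2}
  have hT : Antitone T := antitone_nat_of_succ_le fun n q hq =>
    ⟨(hsub n (S n)).1 hq.1, (hsub n (S n)).2 hq.2⟩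
  let H : Filter (G × G) := ⨅ n, (𝓟 (T n) ⊓ comap Prod.snd (F : Filter G))
  have hH : H.NeBot := by
    refine Filter.iInf_neBot_of_directed
      (Antitone.directed_ge fun m n h => inf_le_inf_right _ (principal_mono.2 (hT h))) fun n => ?_
    obtain ⟨b, hb, N, hN, hev⟩ := (S n).2.2.2
    refine inf_neBot_iff.2 fun {s} hs {s'} hs' => ?_
    obtain ⟨f, hf, hfs⟩ := hs'
    obtain ⟨g, hgf, hg⟩ := F.nonempty_of_mem (inter_mem hf hev)
    exact ⟨(b, g), hs ⟨hb, by simpa using hg 1 (mem_of_mem_nhds hN)⟩, hfs hgf⟩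
  let Q : Ultrafilter (G × G) := Ultrafilter.of H
  have hQT : ∀ n, T n ∈ Q := fun n => Ultrafilter.of_le H
    (mem_iInf_of_mem n (mem_inf_of_left (mem_principal_self _)))
  have hQF : Q.map Prod.snd = F := by
    refine Ultrafilter.coe_le_coe.1 ?_
    have h : (Q : Filter (G × G)) ≤ comap Prod.snd (F : Filter G) :=
      (Ultrafilter.of_le H).trans ((iInf_le _ 0).trans inf_le_right)
    exact map_le_iff_le_comap.2 h
  obtain ⟨z, hz⟩ := hP.converges (Q.map Prod.fst) fun n =>
    ⟨(S (n + 1)).1.1, Ultrafilter.mem_map.2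
      (mem_of_superset (hQT (n + 1)) fun q hq => hq.1), hPA n (S n)⟩
  obtain ⟨y, hy⟩ := hP.converges (Q.map fun q => q.1 * q.2) fun n =>
    ⟨(S (n + 1)).1.2, Ultrafilter.mem_map.2
      (mem_of_superset (hQT (n + 1)) fun q hq => hq.2), hPB n (S n)⟩
  have hz' : Tendsto Prod.fst (Q : Filter (G × G)) (𝓝 z) := hz
  have hy' : Tendsto (fun q : G × G => q.1 * q.2) Q (𝓝 y) := hy
  have h := hz'.inv.mul hy'
  simp only [inv_mul_cancel_left] at h
  exact ⟨z⁻¹ * y, hQF ▸ h⟩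

theorem IsCompletePiBase.exists_le_nhds_of_isTwoSidedCauchy {U : Set G} {P : ℕ → Set G → Prop}
    (hP : IsCompletePiBase U P) {F : Ultrafilter G} (hF : IsTwoSidedCauchy (F : Filter G)) :
    ∃ x, (F : Filter G) ≤ 𝓝 x := by
  obtain ⟨u, hu⟩ := hP.nonempty
  have hcont : Tendsto (fun q : G × G => q.1 * (u * q.2)) (𝓝 1 ×ˢ 𝓝 1) (𝓝 u) := by
    have : Continuous fun q : G × G => q.1 * (u * q.2) := by fun_prop
    simpa [nhds_prod_eq] using this.tendsto (1, 1)
  obtain ⟨V, hV, W, hW, hVW⟩ := mem_prod_iff.1 (hcont (hP.isOpen.mem_nhds hu))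
  -- Translating by `g₀⁻¹` brings the limit near `1`, so that it keeps `u` inside `U`.
  obtain ⟨f, hf, hfW⟩ := hF W hW
  obtain ⟨g₀, hg₀⟩ := F.nonempty_of_mem hf
  have hcauchy : IsTwoSidedCauchy (F.map (· * g₀⁻¹) : Filter G) := by
    intro N hN
    have hconj : Tendsto (fun n : G => g₀ * n * g₀⁻¹) (𝓝 1) (𝓝 1) := by
      have : Continuous fun n : G => g₀ * n * g₀⁻¹ := by fun_prop
      simpa using this.tendsto 1
    obtain ⟨f', hf', h⟩ := hF _ (inter_mem hN (hconj hN))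
    refine ⟨(· * g₀⁻¹) '' f', image_mem_map hf', ?_⟩
    rintro _ ⟨g, hg, rfl⟩ _ ⟨k, hk, rfl⟩
    refine ⟨?_, ?_⟩
    · simpa [mul_assoc] using (h g hg k hk).1.2
    · simpa using (h g hg k hk).2.1
  have hev : MulLimitInterior (F.map (· * g₀⁻¹) : Filter G) u U :=
    ⟨V, hV, eventually_map.2 (mem_of_superset hf fun g hg n hn =>
      hVW (mk_mem_prod hn (hfW g hg g₀ hg₀).2))⟩
  obtain ⟨x, hx⟩ := exists_le_nhds_of_mulLimitInterior hP hcauchy hu hev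
  have hx' : Tendsto (· * g₀⁻¹) (F : Filter G) (𝓝 x) := hx
  exact ⟨x * g₀, by simpa [Tendsto] using hx'.mul_const g₀⟩

/-- The points close to `g` with respect to both uniformities, at the scale `N`. -/
def twoSidedNhd (N : Set G) (g : G) : Set G :=
  {x | g⁻¹ * x ∈ N ∧ x * g⁻¹ ∈ N}

/-- Some `M n` is covered by finitely many translates of a small `W`, and the ultrafilter selects
one of them, on each side. -/
theorem IsCompleteNhdsSeq.isTwoSidedCauchy {M : ℕ → Set G} (hM : IsCompleteNhdsSeq 1 M)
    {F : Ultrafilter G} (hF : ∀ n, ∃ g, twoSidedNhd (M n) g ∈ F) :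
    IsTwoSidedCauchy (F : Filter G) := by
  intro N hN
  have hleft : Tendsto (fun q : G × G => q.1⁻¹ * q.2) (𝓝 1 ×ˢ 𝓝 1) (𝓝 1) := by
    have : Continuous fun q : G × G => q.1⁻¹ * q.2 := by fun_prop
    simpa [nhds_prod_eq] using this.tendsto (1, 1)
  have hright : Tendsto (fun q : G × G => q.1 * q.2⁻¹) (𝓝 1 ×ˢ 𝓝 1) (𝓝 1) := by
    have : Continuous fun q : G × G => q.1 * q.2⁻¹ := by fun_prop
    simpa [nhds_prod_eq] using this.tendsto (1, 1)
  obtain ⟨V, hV, hVN⟩ := mem_prod_self_iff.1 (inter_mem (hleft hN) (hright hN))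
  obtain ⟨W, hWV, hW, h1W⟩ := mem_nhds_iff.1 hV
  have hl : ∃ c, {x | c⁻¹ * x ∈ W} ∈ F := by
    obtain ⟨n, t, hn⟩ := hM.exists_subset_biUnion (fun y => {z | y⁻¹ * z ∈ W})
      (fun y => hW.preimage (continuous_const_mul y⁻¹)) (by simpa using h1W)
    obtain ⟨g, hg⟩ := hF n
    have : (⋃ y ∈ t, {x | y⁻¹ * (g⁻¹ * x) ∈ W}) ∈ F := mem_of_superset hg fun x hx => by
      simpa using hn hx.1
    obtain ⟨y, -, hy⟩ := (Ultrafilter.finite_biUnion_mem_iff t.finite_toSet).1 this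
    exact ⟨g * y, by simpa [mul_assoc] using hy⟩
  have hr : ∃ c, {x | x * c⁻¹ ∈ W} ∈ F := by
    obtain ⟨n, t, hn⟩ := hM.exists_subset_biUnion (fun y => {z | z * y⁻¹ ∈ W})
      (fun y => hW.preimage (continuous_mul_const y⁻¹)) (by simpa using h1W)
    obtain ⟨g, hg⟩ := hF n
    have : (⋃ y ∈ t, {x | x * g⁻¹ * y⁻¹ ∈ W}) ∈ F := mem_of_superset hg fun x hx => by
      simpa using hn hx.2
    obtain ⟨y, -, hy⟩ := (Ultrafilter.finite_biUnion_mem_iff t.finite_toSet).1 this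
    exact ⟨y * g, by simpa [mul_assoc] using hy⟩
  obtain ⟨c, hc⟩ := hl
  obtain ⟨d, hd⟩ := hr
  refine ⟨_, inter_mem hc hd, fun g hg h hh => ⟨?_, ?_⟩⟩
  · have : (c⁻¹ * g)⁻¹ * (c⁻¹ * h) ∈ N := (hVN (mk_mem_prod (hWV hg.1) (hWV hh.1))).1
    convert this using 1
    group
  · have : (g * d⁻¹) * (h * d⁻¹)⁻¹ ∈ N := (hVN (mk_mem_prod (hWV hg.2) (hWV hh.2))).2
    convert this using 1
    group

end Raikov

/-! ### Čech completeness and σ-compact remainders -/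

/-- The ultrafilter form of Čech completeness: a sequence of open covers such that every
ultrafilter meeting all of them converges. -/
def HasCompleteCoverSeq (X : Type*) [TopologicalSpace X] : Prop :=
  ∃ C : ℕ → X → Set X, (∀ n x, IsOpen (C n x) ∧ x ∈ C n x) ∧
    ∀ F : Ultrafilter X, (∀ n, ∃ x, C n x ∈ F) → ∃ x, (F : Filter X) ≤ 𝓝 x

theorem IsCompletePiBase.hasCompleteCoverSeq {G : Type*} [Group G] [TopologicalSpace G]
    [T3Space G] [ContinuousMul G] (hgentle : IsKGentle (fun x : G => x⁻¹)) {U : Set G}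
    {P : ℕ → Set G → Prop} (hP : IsCompletePiBase U P) : HasCompleteCoverSeq G := by
  obtain ⟨x, M', hM'⟩ := hP.exists_isCompleteNhdsSeq
  obtain ⟨M, hM⟩ : ∃ M, IsCompleteNhdsSeq (1 : G) M :=
    ⟨_, by simpa using hM'.image_homeomorph (Homeomorph.mulLeft x⁻¹)⟩
  have := isTopologicalGroup_of_tendsto_inv_one (tendsto_inv_one_of_isKGentle hM hgentle)
  refine ⟨fun n => twoSidedNhd (M n), fun n g => ⟨?_, ?_⟩, fun F hF =>
    hP.exists_le_nhds_of_isTwoSidedCauchy (hM.isTwoSidedCauchy hF)⟩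
  · exact ((hM.isOpen n).preimage (continuous_const_mul g⁻¹)).inter
      ((hM.isOpen n).preimage (continuous_mul_const g⁻¹))
  · simpa [twoSidedNhd] using hM.mem n

theorem HasCompleteCoverSeq.sigmaCompactSpace_remainder {X K : Type*} [TopologicalSpace X]
    [TopologicalSpace K] (hX : HasCompleteCoverSeq X) {e : X → K}
    (he : IsHausdorffCompactification e) : SigmaCompactSpace (remainder e) := by
  obtain ⟨C, hC, hconv⟩ := hX
  have := he.compactSpace
  have := he.t2Space
  let O : ℕ → Set K := fun n => ⋃₀ {V | IsOpen V ∧ ∃ x, e ⁻¹' V ⊆ C n x}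
  have hO : ∀ n, IsOpen (O n) := fun n => isOpen_sUnion fun V hV => hV.1
  have heq : remainder e = ⋃ n, (O n)ᶜ := by
    rw [remainder, ← compl_iInter, compl_inj_iff]
    refine Subset.antisymm ?_ fun k hk => ?_
    · rintro _ ⟨x, rfl⟩
      refine mem_iInter.2 fun n => ?_
      obtain ⟨V, hV, hVC⟩ := he.isEmbedding.isOpen_iff.1 (hC n x).1
      exact ⟨V, ⟨hV, x, hVC.subset⟩, by simpa [← hVC] using (hC n x).2⟩
    -- The trace on `X` of the neighbourhoods of `k` meets every cover, so it has a limit in `X`,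
    -- which must be `k`.
    · have hne : (comap e (𝓝 k)).NeBot :=
        comap_neBot_iff_frequently.2 (mem_closure_iff_frequently.1 (he.denseRange k))
      let F := Ultrafilter.of (comap e (𝓝 k))
      have hF : Tendsto e F (𝓝 k) := map_le_iff_le_comap.2 (Ultrafilter.of_le _)
      obtain ⟨x, hx⟩ := hconv F fun n => by
        obtain ⟨V, ⟨hV, x, hVx⟩, hkV⟩ := mem_iInter.1 hk n
        exact ⟨x, mem_of_superset (hF (hV.mem_nhds hkV)) hVx⟩
      exact ⟨x, tendsto_nhds_unique ((he.isEmbedding.continuous.tendsto x).comp hx) hF⟩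
  rw [← isSigmaCompact_iff_sigmaCompactSpace, heq]
  exact isSigmaCompact_iUnion_of_isCompact _ fun n => (hO n).isClosed_compl.isCompact

/-! ### Remainders that are not Baire -/

theorem locallyCompactSpace_of_range_mem_nhds {G K : Type*} [Group G] [TopologicalSpace G]
    [T2Space G] [ContinuousMul G] [TopologicalSpace K] [CompactSpace K] [T2Space K] {e : G → K}
    (he : IsEmbedding e) {g : G} (hg : range e ∈ 𝓝 (e g)) : LocallyCompactSpace G := by
  obtain ⟨C, hC, hCr, hCc⟩ := local_compact_nhds hg
  have hcomp : IsCompact (e ⁻¹' C) := he.isInducing.isCompact_preimage_iff hCr |>.2 hCc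
  have hmem : e ⁻¹' C ∈ 𝓝 g := he.continuous.continuousAt hC
  have : WeaklyLocallyCompactSpace G := ⟨fun x => by
    refine ⟨(fun y => x * g⁻¹ * y) '' (e ⁻¹' C), hcomp.image (continuous_const_mul _), ?_⟩
    simpa using (Homeomorph.mulLeft (x * g⁻¹)).isOpenMap.image_mem_nhds hmem⟩
  infer_instance

theorem exists_isCompletePiBase_of_not_baireSpace {X K : Type*} [TopologicalSpace X]
    [TopologicalSpace K] {e : X → K} (he : IsHausdorffCompactification e)
    (hdense : Dense (remainder e)) (hB : ¬ BaireSpace (remainder e)) :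
    ∃ U P, IsCompletePiBase (X := X) U P := by
  have := he.compactSpace
  have := he.t2Space
  obtain ⟨T, hT, hTd, hTn⟩ : ∃ T : ℕ → Set (remainder e), (∀ n, IsOpen (T n)) ∧
      (∀ n, Dense (T n)) ∧ ¬ Dense (⋂ n, T n) := by
    by_contra! h
    exact hB ⟨fun T h1 h2 => h T h1 h2⟩
  choose D hD hDT using fun n => isOpen_induced_iff.1 (hT n)
  have hDd : ∀ n, Dense (D n) := fun n => by
    have := hdense.denseRange_val.dense_image continuous_subtype_val (hTd n)
    refine this.mono ?_
    rw [← hDT n]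
    exact image_preimage_subset _ _
  obtain ⟨S, hS, hSne, hST⟩ : ∃ S : Set (remainder e), IsOpen S ∧ S.Nonempty ∧
      S ∩ ⋂ n, T n = ∅ := by
    rw [dense_iff_inter_open] at hTn
    push Not at hTn
    exact hTn
  obtain ⟨V, hV, rfl⟩ := isOpen_induced_iff.1 hS
  have hrange : ∀ k ∈ V, (∀ n, k ∈ D n) → k ∈ range e := by
    intro k hkV hkD
    by_contra hk
    have : (⟨k, hk⟩ : remainder e) ∈ Subtype.val ⁻¹' V ∩ ⋂ n, T n :=
      ⟨hkV, mem_iInter.2 fun n => by rw [← hDT n]; exact hkD n⟩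
    rw [hST] at this
    exact this
  refine ⟨e ⁻¹' V, fun n O => closure (e '' O) ⊆ V ∩ D n,
    hV.preimage he.isEmbedding.continuous, ?_, ?_, ?_⟩
  · obtain ⟨y, hy⟩ := hSne
    obtain ⟨x, hx⟩ := he.denseRange.exists_mem_open hV ⟨_, hy⟩
    exact ⟨x, hx⟩
  · rintro n O hO ⟨x, hx⟩ hOV
    obtain ⟨W, hW, rfl⟩ := he.isEmbedding.isOpen_iff.1 hO
    obtain ⟨k, hk, hkD⟩ := (hDd n).inter_open_nonempty _ (hW.inter hV) ⟨e x, hx, hOV hx⟩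
    obtain ⟨Z, hZ, hkZ, hcl⟩ := exists_open_nhds_closure_subset ((hW.inter hV).inter (hD n))
      (⟨hk, hkD⟩ : k ∈ W ∩ V ∩ D n)
    refine ⟨e ⁻¹' Z, fun y hy => (hcl (subset_closure hy)).1.1,
      hZ.preimage he.isEmbedding.continuous, he.denseRange.exists_mem_open hZ ⟨k, hkZ⟩, ?_⟩
    exact (closure_mono (image_preimage_subset _ _)).trans
      fun y hy => ⟨(hcl hy).1.2, (hcl hy).2⟩
  · intro F hF
    -- The closures in `P` keep the limit in `K` inside `V` and every `D n`, hence inside `range e`.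
    have hle : (F.map e : Filter K) ≤ 𝓝 (F.map e).lim := (F.map e).le_nhds_lim
    have hmem : ∀ n, (F.map e).lim ∈ V ∩ D n := fun n => by
      obtain ⟨O, hO, hOV⟩ := hF n
      exact hOV (mem_closure_iff_ultrafilter.2 ⟨F.map e, image_mem_map hO, hle⟩)
    obtain ⟨x, hx⟩ := hrange _ (hmem 0).1 fun n => (hmem n).2
    refine ⟨x, ?_⟩
    rw [he.isEmbedding.nhds_eq_comap, hx]
    exact map_le_iff_le_comap.1 hle

theorem corollaryc0 {G : Type*} [Group G] [TopologicalSpace G] [T35Space G] [ContinuousMul G]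
    (hG : ¬ LocallyCompactSpace G) (hgentle : IsKGentle (fun x : G => x⁻¹)) :
    (∀ (K : Type*) [TopologicalSpace K] (e : G → K), IsHausdorffCompactification e →
      BaireSpace (remainder e)) ∨
    (∀ (K : Type*) [TopologicalSpace K] (e : G → K), IsHausdorffCompactification e →
      SigmaCompactSpace (remainder e)) := by
  refine or_iff_not_imp_left.2 fun h => ?_
  push Not at h
  obtain ⟨K, _, e, he, hB⟩ := h
  have := he.compactSpace
  have := he.t2Space
  have hdense : Dense (remainder e) := by
    rw [remainder, ← interior_eq_empty_iff_dense_compl, eq_empty_iff_forall_notMem]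
    intro k hk
    obtain ⟨g, rfl⟩ := interior_subset hk
    exact hG (locallyCompactSpace_of_range_mem_nhds he.isEmbedding (mem_interior_iff_mem_nhds.1 hk))
  obtain ⟨U, P, hP⟩ := exists_isCompletePiBase_of_not_baireSpace he hdense hB
  exact fun _ _ _ he' => (hP.hasCompleteCoverSeq hgentle).sigmaCompactSpace_remainder he'
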